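/- Let $L/K$ be a Galois extension of number fields whose Galois group is cyclic. For a maximal ideal $\mathfrak p$ of $\mathcal O_K$ and an integer $f\ge 1$, let $\Pi_{\mathfrak p^f}(L/K)$ be the product of all maximal ideals $\mathfrak P$ of $\mathcal O_L$ with $N_{L/K}(\mathfrak P)=\mathfrak p^f$ (equal to $\mathcal O_L$ if there are none), and let the relative Pólya group $\mathcal Po(L/K)$ be the subgroup of the class group of $L$ generated by the classes of all the ideals $\Pi_{\mathfrak p^f}(L/K)$. Let $h_K$ be the class number of $K$. For a maximal ideal $\mathfrak p$ of $\mathcal O_K$, let $e_{\mathfrak p}(L/K)$ be the ramification index of $\mathfrak p$ in $L/K$; for an infinite place $\mathfrak p\mid\infty$ of $K$, let $e_{\mathfrak p}(L/K)=2$ if $\mathfrak p$ is real and the places of $L$ above it are complex, and $e_{\mathfrak p}(L/K)=1$ otherwise. Then $e_{\mathfrak p}(L/K)=1$ for all but finitely many maximal ideals $\mathfrak p$, the subgroup $N_{L/K}(\mathcal O_L^\times)$ has finite index in $\mathcal O_K^\times$, and $$|\mathcal Po(L/K)|=\frac{h_K}{[L:K]}\times\frac{\prod_{\mathfrak p\in\mathrm{Max}(\mathcal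 O_K)}e_{\mathfrak p}(L/K)\times\prod_{\mathfrak p\mid\infty}e_{\mathfrak p}(L/K)}{(\mathcal O_K^\times:N_{L/K}(\mathcal O_L^\times))}.$$ -/

import Mathlib

open NumberField IsDedekindDomain

namespace RelativePolya

noncomputable section

/-- A nonzero prime ideal of `𝓞 L` whose relative norm is a power of `p` lies over `p`; hence there
are only finitely many of them with a given norm. -/
theorem finite_setOf_relNorm_eq (K L : Type*) [Field K] [NumberField K] [Field L] [NumberField L]
    [Algebra K L] (p : HeightOneSpectrum (𝓞 K)) (f : ℕ) :
    {P : HeightOneSpectrum (𝓞 L) |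
      Ideal.relNorm (𝓞 K) P.asIdeal = p.asIdeal ^ f}.Finite := by
  have hp : p.asIdeal.IsMaximal := p.isMaximal
  refine Set.Finite.of_finite_image (f := HeightOneSpectrum.asIdeal)
    ((IsDedekindDomain.primesOver_finite p.asIdeal (𝓞 L)).subset ?_)
    (fun P _ Q _ h => HeightOneSpectrum.ext h)
  rintro _ ⟨P, hP, rfl⟩
  refine ⟨P.isPrime, ⟨?_⟩⟩
  have h := Ideal.relNorm_le_comap (𝓞 K) P.asIdeal
  rw [show Ideal.relNorm (𝓞 K) P.asIdeal = p.asIdeal ^ f from hP] at h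
  have : (P.asIdeal.comap (algebraMap (𝓞 K) (𝓞 L))).IsPrime := P.isPrime.comap _
  exact hp.eq_of_le this.ne_top (Ideal.IsPrime.le_of_pow_le h)

/-- `Π_{p^f}(L/K)`: the product of the maximal ideals of `𝓞 L` whose relative norm to `K`
is `p ^ f` (the unit ideal if there are none). -/
def prodIdeal (K L : Type*) [Field K] [NumberField K] [Field L] [NumberField L] [Algebra K L]
    (p : HeightOneSpectrum (𝓞 K)) (f : ℕ) : Ideal (𝓞 L) :=
  ∏ P ∈ (finite_setOf_relNorm_eq K L p f).toFinset, P.asIdeal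

theorem prodIdeal_mem_nonZeroDivisors (K L : Type*) [Field K] [NumberField K] [Field L]
    [NumberField L] [Algebra K L] (p : HeightOneSpectrum (𝓞 K)) (f : ℕ) :
    prodIdeal K L p f ∈ nonZeroDivisors (Ideal (𝓞 L)) :=
  mem_nonZeroDivisors_iff_ne_zero.mpr (Finset.prod_ne_zero_iff.mpr fun P _ => P.ne_bot)

/-- The relative Pólya group `Po(L/K)`: the subgroup of the class group of `L` generated by the
classes of the ideals `Π_{p^f}(L/K)`, for `p` a maximal ideal of `𝓞 K` and `f ≥ 1`. -/
def polyaGroup (K L : Type*) [Field K] [NumberField K] [Field L] [NumberField L] [Algebra K L] :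
    Subgroup (ClassGroup (𝓞 L)) :=
  Subgroup.closure {c | ∃ (p : HeightOneSpectrum (𝓞 K)) (f : ℕ), 1 ≤ f ∧
    c = ClassGroup.mk0 ⟨prodIdeal K L p f, prodIdeal_mem_nonZeroDivisors K L p f⟩}

/-- The ramification index in `L/K` of a maximal ideal `p` of `𝓞 K`: the common ramification index
over `p` of the primes of `𝓞 L` above `p`. It is used only for `L/K` Galois, where this common
value exists. -/
def finiteRamificationIdx (K L : Type*) [Field K] [NumberField K] [Field L] [NumberField L]
    [Algebra K L] (p : HeightOneSpectrum (𝓞 K)) : ℕ :=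
  p.asIdeal.ramificationIdxIn (𝓞 L)

open scoped Classical in
/-- The ramification index in `L/K` of an infinite place `v` of `K`: it is `1` if `v` is unramified
in `L`, and `2` if `v` is ramified, that is, if `v` is real with a complex place above it
(used for `L/K` Galois). -/
def infiniteRamificationIdx (K L : Type*) [Field K] [NumberField K] [Field L] [NumberField L]
    [Algebra K L] (v : InfinitePlace K) : ℕ :=
  if v.IsUnramifiedIn L then 1 else 2

/-- The subgroup `N_{L/K}(𝓞_L^×)` of `𝓞_K^×`. -/
def unitNorms (K L : Type*) [Field K] [NumberField K] [Field L] [NumberField L] [Algebra K L] :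
    Subgroup (𝓞 K)ˣ :=
  (Units.map (RingOfIntegers.norm K : 𝓞 L →* 𝓞 K)).range

end

end RelativePolya

/-!
The formula is Chevalley's ambiguous class number formula. As `L/K` is Galois, `Π_{p^f}(L/K)` is
either trivial or the product of all primes above `p`, so `Po(L/K)` is the quotient of the free
abelian group `D` on the maximal ideals `p` of `K` by the subgroup `R` of those combinations of the
ideals `Π_p = ∏_{P ∣ p} P` that are principal in `L` (`card_polyaGroup`).

The principal divisors of `K` have index `h_K` in `D` (`index_ker_divisorClass`). Since
`p 𝓞_L = Π_p ^ e_p`, extending them to `L` multiplies the coordinate at `p` by `e_p`, and gives a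
subgroup `B ≤ R` of index `h_K ∏ e_p` in `D` (`index_range_scale`). Let `σ` generate the Galois
group. A divisor of an element `x` of `Lˣ` comes from `D` exactly when `σ x / x` is a unit
(`map_principalDiv_comap_diffEnd`), so `R / B` is the group of these `x` modulo `Kˣ` and units. By
Hilbert's Theorem 90 that group is the first cohomology `H¹` of the units of `L`
(`relIndex_range_diffEnd_units`), whence `|H¹| |Po(L/K)| = h_K ∏ e_p`
(`relIndex_mul_card_polyaGroup`).

It remains to compare `H¹` with the zeroth Tate cohomology of the units, which is the group of units
of `K` modulo norms (`relIndex_range_normEnd_units`). The Herbrand quotient of `𝓞_Lˣ` is found as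
follows (`herbrand_units`). Dirichlet's theorem provides units `y w`, one for each infinite place
`w` of `L`, permuted by the Galois group in the same way as the places and small at all other places
(`exists_equivariant_units`). The elements `(y w, 1)` are then linearly independent in `𝓞_Lˣ × ℤ`
and span a subgroup of finite index, isomorphic to the permutation module on the infinite places. A
Herbrand quotient does not change on passing to a subgroup of finite index
(`herbrand_of_finiteIndex`). It is multiplicative on products, it is `[L : K]` for `ℤ`, and for the
permutation module it is the product of the orders of the decomposition groups, that is,
`∏_{v ∣ ∞} e_v`.

Cohomology groups enter only through relative indices of kernels and images of the endomorphisms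
`∑ τ, τ` and `σ - 1` of abelian groups, written additively.
-/

namespace RelativePolya

/-! ### Herbrand quotients of abelian groups with two endomorphisms -/

/-- A homomorphism distributes the index of a subgroup between its image and its kernel. -/
theorem index_eq_relIndex_range_mul_relIndex_ker {A C : Type*} [AddCommGroup A] [AddCommGroup C]
    (f : A →+ C) (B : AddSubgroup A) :
    B.index = (B.map f).relIndex f.range * B.relIndex f.ker := by
  rw [← AddSubgroup.relIndex_mul_index (le_sup_left : B ≤ B ⊔ f.ker),
    AddSubgroup.relIndex_sup_left, AddMonoidHom.range_eq_map, AddSubgroup.relIndex_map_map,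
    top_sup_eq, AddSubgroup.relIndex_top_right, mul_comm]

/-- Let `f` and `g` be endomorphisms of an abelian group `A` with `f ∘ g = g ∘ f = 0`. The Herbrand
quotient `[ker f : im g] / [ker g : im f]` does not change on passing to a subgroup of finite
index stable under `f` and `g`, here the image of an injection `j`. -/
theorem herbrand_of_finiteIndex {A B : Type*} [AddCommGroup A] [AddCommGroup B]
    {j : B →+ A} (hj : Function.Injective j) (hfin : j.range.index ≠ 0)
    {f g : A →+ A} {f' g' : B →+ B} (hf : ∀ b, j (f' b) = f (j b)) (hg : ∀ b, j (g' b) = g (j b))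
    (hfg : ∀ a, f (g a) = 0) (hgf : ∀ a, g (f a) = 0) :
    g.range.relIndex f.ker * f'.range.relIndex g'.ker =
      f.range.relIndex g.ker * g'.range.relIndex f'.ker ∧
    (g'.range.relIndex f'.ker ≠ 0 → g.range.relIndex f.ker ≠ 0) ∧
    (f'.range.relIndex g'.ker ≠ 0 → f.range.relIndex g.ker ≠ 0) := by
  -- the index computation for one ordered pair of endomorphisms
  have key : ∀ {f g : A →+ A} {f' g' : B →+ B}, (∀ b, j (f' b) = f (j b)) →
      (∀ b, j (g' b) = g (j b)) → (∀ a, f (g a) = 0) →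
      (j.range.map g).relIndex g.range * g.range.relIndex f.ker =
        g'.range.relIndex f'.ker * j.range.relIndex f.ker := by
    intro f g f' g' hf hg hfg
    have h1 : j.range.map g = g'.range.map j := by
      ext x
      constructor
      · rintro ⟨_, ⟨b, rfl⟩, rfl⟩
        exact ⟨g' b, ⟨b, rfl⟩, hg b⟩
      · rintro ⟨_, ⟨b, rfl⟩, rfl⟩
        exact ⟨j b, ⟨b, rfl⟩, (hg b).symm⟩
    have h2 : j.range ⊓ f.ker = f'.ker.map j := by
      ext x
      constructor
      · rintro ⟨⟨b, rfl⟩, h⟩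
        refine ⟨b, hj ?_, rfl⟩
        rw [hf, map_zero]
        exact h
      · rintro ⟨b, hb, rfl⟩
        refine ⟨⟨b, rfl⟩, ?_⟩
        change f (j b) = 0
        rw [← hf, show f' b = 0 from hb, map_zero]
    have hgf' : g.range ≤ f.ker := by
      rintro _ ⟨a, rfl⟩
      exact hfg a
    have h3 : j.range.map g ≤ g.range := by
      rintro _ ⟨a, -, rfl⟩
      exact ⟨a, rfl⟩
    have h4 : g'.range.map j ≤ f'.ker.map j := by
      rw [← h1, ← h2]
      refine le_inf ?_ (h3.trans hgf')
      rw [h1]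
      rintro _ ⟨b, -, rfl⟩
      exact ⟨b, rfl⟩
    rw [AddSubgroup.relIndex_mul_relIndex _ _ _ h3 hgf', h1,
      ← AddSubgroup.relIndex_map_map_of_injective g'.range f'.ker hj,
      ← AddSubgroup.inf_relIndex_right j.range f.ker, h2,
      AddSubgroup.relIndex_mul_relIndex _ _ _ h4]
    rw [← h2]
    exact inf_le_right
  have k1 := key hf hg hfg
  have k2 := key hg hf hgf
  have i1 := index_eq_relIndex_range_mul_relIndex_ker f j.range
  have i2 := index_eq_relIndex_range_mul_relIndex_ker g j.range
  generalize (j.range.map g).relIndex g.range = ig at *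
  generalize (j.range.map f).relIndex f.range = jf at *
  generalize j.range.relIndex f.ker = kf at *
  generalize j.range.relIndex g.ker = kg at *
  generalize j.range.index = n at *
  generalize g.range.relIndex f.ker = a at *
  generalize f.range.relIndex g.ker = b at *
  generalize g'.range.relIndex f'.ker = c at *
  generalize f'.range.relIndex g'.ker = d at *
  refine ⟨?_, ?_, ?_⟩
  · apply Nat.eq_of_mul_eq_mul_right (Nat.pos_of_ne_zero hfin)
    calc a * d * n = (ig * a) * (d * kg) := by rw [i2]; ring
      _ = (c * kf) * (jf * b) := by rw [k1, k2]
      _ = b * c * n := by rw [i1]; ring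
  · rintro hc rfl
    rw [mul_zero] at k1
    rcases mul_eq_zero.mp k1.symm with h | h
    · exact hc h
    · exact hfin (by rw [i1, h, mul_zero])
  · rintro hd rfl
    rw [mul_zero] at k2
    rcases mul_eq_zero.mp k2.symm with h | h
    · exact hd h
    · exact hfin (by rw [i2, h, mul_zero])

theorem relIndex_range_prodMap {A C : Type*} [AddCommGroup A] [AddCommGroup C]
    (f g : A →+ A) (f' g' : C →+ C) :
    (g.prodMap g').range.relIndex (f.prodMap f').ker =
      g.range.relIndex f.ker * g'.range.relIndex f'.ker := by
  let e : (f.prodMap f').ker →+ f.ker × f'.ker :=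
    (AddMonoidHom.prod
      (((AddMonoidHom.fst A C).comp (f.prodMap f').ker.subtype).codRestrict f.ker
        fun x => congrArg Prod.fst (show f.prodMap f' x = 0 from x.2))
      (((AddMonoidHom.snd A C).comp (f.prodMap f').ker.subtype).codRestrict f'.ker
        fun x => congrArg Prod.snd (show f.prodMap f' x = 0 from x.2)))
  have he : Function.Surjective e := by
    rintro ⟨⟨x, hx⟩, ⟨y, hy⟩⟩
    exact ⟨⟨(x, y), Prod.ext hx hy⟩, rfl⟩
  unfold AddSubgroup.relIndex
  rw [← AddSubgroup.index_prod, ← AddSubgroup.index_comap_of_surjective _ he]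
  congr 1
  ext ⟨⟨x, y⟩, h⟩
  constructor
  · rintro ⟨⟨a, c⟩, h⟩
    exact ⟨⟨a, congrArg Prod.fst h⟩, ⟨c, congrArg Prod.snd h⟩⟩
  · rintro ⟨⟨a, h1⟩, ⟨c, h2⟩⟩
    exact ⟨(a, c), Prod.ext h1 h2⟩

/-! ### Permutation modules of a cyclic group -/

/-- The norm endomorphism `∑ τ, τ` of a module over a finite group. -/
noncomputable def normEnd (G M : Type*) [Group G] [Fintype G] [AddCommGroup M]
    [DistribMulAction G M] : M →+ M :=
  ∑ τ : G, DistribSMul.toAddMonoidHom M τ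

theorem normEnd_apply {G M : Type*} [Group G] [Fintype G] [AddCommGroup M]
    [DistribMulAction G M] (m : M) : normEnd G M m = ∑ τ : G, τ • m := by
  simp [normEnd]

/-- The endomorphism `σ - 1` of a module over a group. -/
def diffEnd {G : Type*} (M : Type*) [Group G] [AddCommGroup M] [DistribMulAction G M] (σ : G) :
    M →+ M :=
  DistribSMul.toAddMonoidHom M σ - AddMonoidHom.id M

theorem diffEnd_apply {G M : Type*} [Group G] [AddCommGroup M] [DistribMulAction G M] (σ : G)
    (m : M) : diffEnd M σ m = σ • m - m := rfl

theorem diffEnd_normEnd {G M : Type*} [Group G] [Fintype G] [AddCommGroup M]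
    [DistribMulAction G M] (σ : G) (m : M) : diffEnd M σ (normEnd G M m) = 0 := by
  rw [diffEnd_apply, normEnd_apply, Finset.smul_sum, sub_eq_zero]
  simp_rw [smul_smul]
  exact Fintype.sum_equiv (Equiv.mulLeft σ) _ _ fun _ => rfl

theorem normEnd_diffEnd {G M : Type*} [Group G] [Fintype G] [AddCommGroup M]
    [DistribMulAction G M] (σ : G) (m : M) : normEnd G M (diffEnd M σ m) = 0 := by
  rw [diffEnd_apply, map_sub, normEnd_apply, normEnd_apply, sub_eq_zero]
  simp_rw [smul_smul]
  exact Fintype.sum_equiv (Equiv.mulRight σ) _ _ fun _ => rfl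

/-- The norm endomorphism `∑ τ, τ` of the permutation module `S → ℤ`, where `τ` acts by
`c ↦ c ∘ τ⁻¹`. -/
def permNorm (G S : Type*) [Group G] [Fintype G] [MulAction G S] : (S → ℤ) →+ (S → ℤ) where
  toFun c s := ∑ τ : G, c (τ⁻¹ • s)
  map_zero' := by ext; simp
  map_add' c d := by ext; simp [Finset.sum_add_distrib]

/-- The endomorphism `σ - 1` of the permutation module `S → ℤ`. -/
def permDiff {G : Type*} (S : Type*) [Group G] [MulAction G S] (σ : G) : (S → ℤ) →+ (S → ℤ) where
  toFun c s := c (σ⁻¹ • s) - c s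
  map_zero' := by ext; simp
  map_add' c d := by ext; simp only [Pi.add_apply]; ring

section Permutation

variable {G S : Type*} [Group G] [MulAction G S] {σ : G}

theorem mem_ker_permDiff (hσ : ∀ τ, τ ∈ Subgroup.zpowers σ) {c : S → ℤ} :
    c ∈ (permDiff S σ).ker ↔ ∀ (τ : G) s, c (τ • s) = c s := by
  constructor
  · intro h
    have h1 : ∀ s, c (σ⁻¹ • s) = c s := fun s => sub_eq_zero.mp (congrFun h s)
    let H : Subgroup G :=
      { carrier := {τ | ∀ s, c (τ • s) = c s}
        one_mem' := fun s => by rw [one_smul]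
        mul_mem' := fun {a b} ha hb s => by rw [mul_smul, ha, hb]
        inv_mem' := fun {a} ha s => by rw [← ha, smul_inv_smul] }
    have hle : Subgroup.zpowers σ ≤ H := by
      rw [Subgroup.zpowers_le, ← inv_mem_iff]
      exact h1
    exact fun τ => hle (hσ τ)
  · intro h
    ext s
    exact sub_eq_zero.mpr (h _ _)

theorem exists_smul_out (s : S) :
    ∃ τ : G, τ • (Quotient.mk (MulAction.orbitRel G S) s).out = s :=
  MulAction.orbitRel_apply.mp
    ((MulAction.orbitRel G S).symm (Quotient.mk_out (s := MulAction.orbitRel G S) s))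

theorem orbitRel_mk_smul (τ : G) (s : S) :
    Quotient.mk (MulAction.orbitRel G S) (τ • s) = Quotient.mk _ s :=
  Quotient.sound (MulAction.orbitRel_apply.mpr ⟨τ, rfl⟩)

variable [Fintype G] [Fintype S]

open scoped Classical in
/-- The norm of a function on a `G`-set at a point is the sum of its values over the orbit of that
point, each counted as often as the stabilizer has elements. -/
theorem permNorm_apply (c : S → ℤ) (t : S) :
    permNorm G S c t =
      Nat.card (MulAction.stabilizer G (Quotient.mk (MulAction.orbitRel G S) t).out) *
        ∑ s with Quotient.mk (MulAction.orbitRel G S) s = Quotient.mk _ t, c s := by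
  have hcard : ∀ s, ((Finset.univ.filter fun τ : G => τ⁻¹ • t = s).card : ℤ) =
      if Quotient.mk (MulAction.orbitRel G S) s = Quotient.mk _ t then
        (Nat.card (MulAction.stabilizer G (Quotient.mk (MulAction.orbitRel G S) t).out) : ℤ)
      else 0 := by
    intro s
    split_ifs with hs
    · obtain ⟨a, ha⟩ := exists_smul_out (G := G) s
      obtain ⟨b, hb⟩ := exists_smul_out (G := G) t
      rw [hs] at ha
      rw [Nat.card_eq_fintype_card, Fintype.card_subtype, Nat.cast_inj]
      refine Finset.card_bij (fun τ _ => a⁻¹ * τ⁻¹ * b) ?_ ?_ ?_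
      · intro τ hτ
        simp only [Finset.mem_filter, Finset.mem_univ, true_and] at hτ ⊢
        rw [MulAction.mem_stabilizer_iff, mul_smul, hb, mul_smul, hτ, inv_smul_eq_iff, ha]
      · intro x _ y _ h
        exact inv_injective (mul_left_cancel (mul_right_cancel h))
      · intro x hx
        simp only [Finset.mem_filter, Finset.mem_univ, true_and,
          MulAction.mem_stabilizer_iff] at hx
        refine ⟨b * x⁻¹ * a⁻¹, ?_, by group⟩
        simp only [Finset.mem_filter, Finset.mem_univ, true_and]
        nth_rewrite 1 [← hb]
        rw [smul_smul, show (b * x⁻¹ * a⁻¹)⁻¹ * b = a * x by group, mul_smul, hx, ha]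
    · rw [Finset.card_eq_zero.mpr, Nat.cast_zero]
      refine Finset.filter_eq_empty_iff.mpr fun τ _ h => hs ?_
      rw [← h, orbitRel_mk_smul]
  calc permNorm G S c t = ∑ s, ∑ τ : G with τ⁻¹ • t = s, c (τ⁻¹ • t) :=
        (Finset.sum_fiberwise _ _ _).symm
    _ = ∑ s, ((Finset.univ.filter fun τ : G => τ⁻¹ • t = s).card : ℤ) * c s := by
        refine Finset.sum_congr rfl fun s _ => ?_
        rw [← nsmul_eq_mul, ← Finset.sum_const]
        exact Finset.sum_congr rfl fun τ hτ => congrArg c (Finset.mem_filter.mp hτ).2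
    _ = _ := by
        simp_rw [hcard, ite_mul, zero_mul, Finset.mul_sum, Finset.sum_filter]

/-- The permutation module has trivial first cohomology. -/
theorem relIndex_range_permDiff (hσ : ∀ τ, τ ∈ Subgroup.zpowers σ) :
    (permDiff S σ).range.relIndex (permNorm G S).ker = 1 := by
  classical
  rw [AddSubgroup.relIndex_eq_one]
  -- modulo the image of `σ - 1`, all points of an orbit become equal
  have hpow : ∀ (τ : G) (s : S),
      (Pi.single (τ • s) 1 - Pi.single s 1 : S → ℤ) ∈ (permDiff S σ).range := by
    let H : Subgroup G :=
      { carrier := {τ | ∀ s, (Pi.single (τ • s) 1 - Pi.single s 1 : S → ℤ) ∈ (permDiff S σ).range}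
        one_mem' := fun s => by rw [one_smul, sub_self]; exact zero_mem _
        mul_mem' := fun {a b} ha hb s => by
          rw [mul_smul, ← sub_add_sub_cancel _ (Pi.single (b • s) 1 : S → ℤ)]
          exact add_mem (ha _) (hb _)
        inv_mem' := fun {a} ha s => by
          have := neg_mem (ha (a⁻¹ • s))
          rwa [smul_inv_smul, neg_sub] at this }
    have hle : Subgroup.zpowers σ ≤ H := by
      rw [Subgroup.zpowers_le]
      intro s
      refine ⟨Pi.single s 1, ?_⟩
      ext t
      change (Pi.single s 1 : S → ℤ) (σ⁻¹ • t) - (Pi.single s 1 : S → ℤ) t = _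
      simp only [Pi.single_apply, Pi.sub_apply, inv_smul_eq_iff]
    exact fun τ => hle (hσ τ)
  intro c hc
  let r : S → S := fun s => (Quotient.mk (MulAction.orbitRel G S) s).out
  choose τ hτ using fun s : S => exists_smul_out (G := G) s
  have h0 : ∑ s, c s • (Pi.single (r s) 1 : S → ℤ) = 0 := by
    ext t
    simp only [Finset.sum_apply, Pi.smul_apply, Pi.single_apply, smul_eq_mul, mul_ite, mul_one,
      mul_zero, Pi.zero_apply]
    by_cases ht : r t = t
    · have h1 := permNorm_apply (G := G) c t
      rw [show permNorm G S c = 0 from hc, Pi.zero_apply, eq_comm, mul_eq_zero,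
        Nat.cast_eq_zero, Finset.sum_filter] at h1
      refine Eq.trans ?_ (h1.resolve_left Nat.card_pos.ne')
      refine Finset.sum_congr rfl fun s _ => if_congr ⟨fun h => ?_, fun h => ?_⟩ rfl rfl
      · rw [h, Quotient.out_eq]
      · rw [← ht]
        exact congrArg Quotient.out h.symm
    · refine Finset.sum_eq_zero fun s _ => if_neg fun h => ht ?_
      simp only [r, h, Quotient.out_eq]
  have hc1 : c = ∑ s, c s • (Pi.single (τ s • r s) 1 - Pi.single (r s) 1 : S → ℤ) := by
    simp_rw [smul_sub, Finset.sum_sub_distrib, h0, sub_zero, r, hτ]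
    ext t
    simp [Finset.sum_apply, Pi.single_apply]
  rw [hc1]
  exact sum_mem fun s _ => zsmul_mem (hpow _ _) _

/-- The zeroth Tate cohomology of a permutation module is the product over the orbits of the
cyclic groups `ℤ / |stabilizer|`. -/
theorem relIndex_range_permNorm [Fintype (MulAction.orbitRel.Quotient G S)]
    (hσ : ∀ τ, τ ∈ Subgroup.zpowers σ) :
    (permNorm G S).range.relIndex (permDiff S σ).ker =
      ∏ ω : MulAction.orbitRel.Quotient G S, Nat.card (MulAction.stabilizer G ω.out) := by
  classical
  let π : S → MulAction.orbitRel.Quotient G S := Quotient.mk (MulAction.orbitRel G S)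
  have hout : ∀ ω : MulAction.orbitRel.Quotient G S, π ω.out = ω := fun ω => Quotient.out_eq ω
  -- invariant functions are functions on the set of orbits
  let q : (MulAction.orbitRel.Quotient G S → ℤ) →+ (S → ℤ) :=
    { toFun := fun c s => c (π s)
      map_zero' := rfl
      map_add' := fun _ _ => rfl }
  have hq : Function.Injective q := fun c d h => by
    ext ω
    obtain ⟨s, rfl⟩ := Quotient.exists_rep ω
    exact congrFun h s
  have h1 : (permDiff S σ).ker = (⊤ : AddSubgroup (MulAction.orbitRel.Quotient G S → ℤ)).map q := by
    ext c
    rw [mem_ker_permDiff hσ]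
    constructor
    · intro h
      refine ⟨fun ω => c ω.out, trivial, ?_⟩
      ext s
      obtain ⟨τ, hτ⟩ := exists_smul_out (G := G) s
      change c (Quotient.out (π s)) = c s
      rw [← h τ]
      exact congrArg c hτ
    · rintro ⟨d, -, rfl⟩ τ s
      exact congrArg d (orbitRel_mk_smul τ s)
  have h2 : (permNorm G S).range = (AddSubgroup.pi Set.univ fun ω =>
      AddSubgroup.zmultiples (Nat.card (MulAction.stabilizer G ω.out) : ℤ)).map q := by
    ext c
    constructor
    · rintro ⟨c, rfl⟩
      refine ⟨fun ω => Nat.card (MulAction.stabilizer G ω.out) * ∑ s with π s = ω, c s, ?_, ?_⟩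
      · intro ω _
        exact Int.mem_zmultiples_iff.mpr (dvd_mul_right _ _)
      · ext t
        exact (permNorm_apply c t).symm
    · rintro ⟨d, hd, rfl⟩
      have hd' : ∀ ω, ∃ m : ℤ, d ω = Nat.card (MulAction.stabilizer G ω.out) * m := fun ω =>
        Int.mem_zmultiples_iff.mp (hd ω trivial)
      choose m hm using hd'
      refine ⟨fun s => if s = (π s).out then m (π s) else 0, ?_⟩
      ext t
      rw [permNorm_apply]
      change _ = d (π t)
      rw [hm, Finset.sum_eq_single (π t).out]
      · rw [hout, if_pos rfl]
      · intro s hs hne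
        rw [if_neg]
        rw [show π s = π t from (Finset.mem_filter.mp hs).2]
        exact hne
      · intro h
        exact (h (by rw [Finset.mem_filter]; exact ⟨Finset.mem_univ _, hout (π t)⟩)).elim
  rw [h1, h2, AddSubgroup.relIndex_map_map_of_injective _ _ hq, AddSubgroup.relIndex_top_right,
    AddSubgroup.index_pi]
  refine Finset.prod_congr rfl fun ω _ => ?_
  rw [Int.index_zmultiples, Int.natAbs_natCast]

end Permutation

/-! ### Units indexed by the infinite places -/

/-- A real square matrix with zero row sums and negative off-diagonal entries has no nonzero left
null vector whose coordinates sum to zero. -/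
theorem eq_zero_of_leftNull_of_sum_eq_zero {S : Type*} [Fintype S] {a : S → S → ℝ}
    (hneg : ∀ w w', w' ≠ w → a w w' < 0) (hrow : ∀ w, ∑ w', a w w' = 0) {c : S → ℝ}
    (hc : ∀ w', ∑ w, c w * a w w' = 0) (hsum : ∑ w, c w = 0) : c = 0 := by
  classical
  have key : ∀ c : S → ℝ, (∀ w', ∑ w, c w * a w w' = 0) → ∑ w, c w = 0 → ∀ w, c w ≤ 0 := by
    intro c hc hsum w₀
    by_contra! h₀
    -- summing the columns over the set `P` of positive coordinates gives only nonnegative terms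
    let P : Finset S := Finset.univ.filter fun w => 0 < c w
    have hP : ∀ w, w ∈ P ↔ 0 < c w := fun w => by simp [P]
    obtain ⟨w₁, hw₁⟩ : ∃ w, w ∉ P := by
      by_contra! h
      exact (Finset.sum_pos (fun w _ => (hP w).mp (h w)) ⟨w₀, Finset.mem_univ _⟩).ne' hsum
    have h1 : ∑ w, c w * ∑ w' ∈ P, a w w' = 0 := by
      simp_rw [Finset.mul_sum]
      rw [Finset.sum_comm]
      exact Finset.sum_eq_zero fun w' _ => hc w'
    have h2 : ∀ w ∈ P, 0 < ∑ w' ∈ P, a w w' := by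
      intro w hw
      have h3 := hrow w
      rw [← Finset.sum_add_sum_compl P] at h3
      have h4 : ∑ w' ∈ Pᶜ, a w w' < 0 := Finset.sum_neg
        (fun w' hw' => hneg w w' fun h => Finset.mem_compl.mp hw' (h ▸ hw))
        ⟨w₁, Finset.mem_compl.mpr hw₁⟩
      linarith
    refine (Finset.sum_pos' (fun w _ => ?_) ⟨w₀, Finset.mem_univ _,
      mul_pos h₀ (h2 w₀ ((hP w₀).mpr h₀))⟩).ne' h1
    by_cases hw : w ∈ P
    · exact mul_nonneg ((hP w).mp hw).le (h2 w hw).le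
    · refine mul_nonneg_of_nonpos_of_nonpos (not_lt.mp fun h => hw ((hP w).mpr h)) ?_
      exact Finset.sum_nonpos fun w' hw' => (hneg w w' fun h => hw (h ▸ hw')).le
  ext w
  refine le_antisymm (key c hc hsum w) ?_
  have := key (-c) (fun w' => by simp [hc]) (by simp [hsum]) w
  simpa using this

/-- The homomorphism from the permutation module `S → ℤ` to `M × ℤ` that sends the basis vector at
`s` to `(y s, 1)`. -/
noncomputable def basisHom {S M : Type*} [Fintype S] [AddCommGroup M] (y : S → M) :
    (S → ℤ) →+ M × ℤ where
  toFun c := (∑ s, c s • y s, ∑ s, c s)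
  map_zero' := by simp
  map_add' c d := by simp [add_smul, Finset.sum_add_distrib]

theorem basisHom_permNorm {G S M : Type*} [Group G] [Fintype G] [MulAction G S] [Fintype S]
    [AddCommGroup M] [DistribMulAction G M] {y : S → M} (hy : ∀ (τ : G) s, τ • y s = y (τ • s))
    (c : S → ℤ) :
    basisHom y (permNorm G S c) =
      (normEnd G M).prodMap (AddMonoidHom.mulLeft (Fintype.card G : ℤ)) (basisHom y c) := by
  refine Prod.ext ?_ ?_
  · change ∑ s, (∑ τ : G, c (τ⁻¹ • s)) • y s = normEnd G M (∑ s, c s • y s)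
    rw [normEnd_apply]
    simp_rw [Finset.sum_smul, Finset.smul_sum]
    rw [Finset.sum_comm]
    refine Finset.sum_congr rfl fun τ _ => ?_
    refine Fintype.sum_equiv (MulAction.toPerm τ⁻¹) _ _ fun s => ?_
    rw [smul_comm τ, hy, MulAction.toPerm_apply, smul_inv_smul]
  · change ∑ s, ∑ τ : G, c (τ⁻¹ • s) = Fintype.card G * ∑ s, c s
    rw [Finset.sum_comm]
    have : ∀ τ : G, ∑ s, c (τ⁻¹ • s) = ∑ s, c s := fun τ =>
      Equiv.sum_comp (MulAction.toPerm τ⁻¹) c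
    simp_rw [this, Finset.sum_const, Finset.card_univ, nsmul_eq_mul]

theorem basisHom_permDiff {G S M : Type*} [Group G] [MulAction G S] [Fintype S]
    [AddCommGroup M] [DistribMulAction G M] {y : S → M} (hy : ∀ (τ : G) s, τ • y s = y (τ • s))
    (σ : G) (c : S → ℤ) :
    basisHom y (permDiff S σ c) = (diffEnd M σ).prodMap 0 (basisHom y c) := by
  refine Prod.ext ?_ ?_
  · change ∑ s, (c (σ⁻¹ • s) - c s) • y s = σ • (∑ s, c s • y s) - ∑ s, c s • y s
    simp_rw [sub_smul, Finset.sum_sub_distrib, Finset.smul_sum]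
    congr 1
    refine Fintype.sum_equiv (MulAction.toPerm σ⁻¹) _ _ fun s => ?_
    rw [smul_comm σ, hy, MulAction.toPerm_apply, smul_inv_smul]
  · change ∑ s, (c (σ⁻¹ • s) - c s) = 0
    rw [Finset.sum_sub_distrib, sub_eq_zero]
    exact Equiv.sum_comp (MulAction.toPerm σ⁻¹) c

section UnitAction

variable {K L : Type*} [Field K] [Field L] [Algebra K L]

/-- The action on the unit group of a ring induced by an action on the ring, written additively. -/
noncomputable instance {G R : Type*} [Group G] [CommRing R] [MulSemiringAction G R] :
    DistribMulAction G (Additive Rˣ) where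
  smul τ u := Additive.ofMul (Units.map (MulSemiringAction.toRingHom G R τ : R →* R) u.toMul)
  one_smul u := Units.ext (one_smul G (u.toMul : R))
  mul_smul σ τ u := Units.ext (mul_smul σ τ (u.toMul : R))
  smul_zero _ := congrArg Additive.ofMul (map_one _)
  smul_add _ _ _ := congrArg Additive.ofMul (map_mul _ _ _)

/-- The logarithm of the absolute value at an infinite place, on units. -/
noncomputable def logAt (w : InfinitePlace L) : Additive (𝓞 L)ˣ →+ ℝ where
  toFun u := Real.log (w ((u.toMul : (𝓞 L)ˣ) : L))
  map_zero' := by simp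
  map_add' u v := by
    simp only [toMul_add, Units.val_mul, map_mul]
    exact Real.log_mul (by simp) (by simp)

theorem logAt_smul (τ : Gal(L/K)) (w : InfinitePlace L) (u : Additive (𝓞 L)ˣ) :
    logAt w (τ • u) = logAt (τ⁻¹ • w) u := rfl

variable [NumberField L]

variable (K L) in
/-- There are units indexed by the infinite places of `L`, permuted by the Galois group in the same
way as the places, each of which is small at all places but its own. -/
theorem exists_equivariant_units [NumberField K] :
    ∃ y : InfinitePlace L → Additive (𝓞 L)ˣ, (∀ (τ : Gal(L/K)) w, τ • y w = y (τ • w)) ∧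
      ∀ w w', w' ≠ w → logAt w' (y w) < 0 := by
  classical
  choose u hu using fun w : InfinitePlace L => Units.dirichletUnitTheorem.exists_unit L w
  -- averaging over the group makes an arbitrary choice of such units equivariant
  refine ⟨fun w => ∑ τ : Gal(L/K), τ • Additive.ofMul (u (τ⁻¹ • w)), fun σ w => ?_,
    fun w w' h => ?_⟩
  · rw [Finset.smul_sum]
    refine Fintype.sum_equiv (Equiv.mulLeft σ) _ _ fun τ => ?_
    simp [smul_smul]
  · rw [map_sum]
    refine Finset.sum_neg (fun τ _ => ?_) ⟨1, Finset.mem_univ _⟩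
    rw [logAt_smul]
    exact hu _ _ fun h' => h (smul_left_cancel _ h')

theorem basisHom_units_injective {y : InfinitePlace L → Additive (𝓞 L)ˣ}
    (hy : ∀ w w', w' ≠ w → logAt w' (y w) < 0) : Function.Injective (basisHom y) := by
  rw [injective_iff_map_eq_zero]
  intro c hc
  have h1 : ∑ w, c w • y w = 0 := congrArg Prod.fst hc
  have h2 : ∑ w, c w = 0 := congrArg Prod.snd hc
  have h3 := eq_zero_of_leftNull_of_sum_eq_zero (c := fun w => (c w : ℝ))
    (a := fun w w' => w'.mult * logAt w' (y w))
    (fun w w' h => mul_neg_of_pos_of_neg (by exact_mod_cast InfinitePlace.mult_pos) (hy w w' h))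
    (fun w => Units.sum_mult_mul_log (y w).toMul) (fun w' => ?_) (by exact_mod_cast h2)
  · ext w
    exact Int.cast_eq_zero.mp (congrFun h3 w)
  · have h4 := congrArg (logAt w') h1
    simp only [map_sum, map_zsmul, zsmul_eq_mul, map_zero] at h4
    calc _ = (w'.mult : ℝ) * ∑ w, c w * logAt w' (y w) := by
          rw [Finset.mul_sum]
          exact Finset.sum_congr rfl fun w _ => mul_left_comm _ _ _
      _ = 0 := by rw [h4, mul_zero]

/-- The image of `basisHom` has finite index, by the rank part of Dirichlet's unit theorem. -/
theorem index_range_basisHom_units_ne_zero {y : InfinitePlace L → Additive (𝓞 L)ˣ}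
    (hy : ∀ w w', w' ≠ w → logAt w' (y w) < 0) : (basisHom y).range.index ≠ 0 := by
  let f : (InfinitePlace L → ℤ) →ₗ[ℤ] Additive (𝓞 L)ˣ × ℤ := (basisHom y).toIntLinearMap
  have h1 : Module.finrank ℤ f.range = Fintype.card (InfinitePlace L) := by
    rw [LinearMap.finrank_range_of_inj (f := f) (basisHom_units_injective hy),
      Module.finrank_fintype_fun_eq_card]
  have h2 : Module.finrank ℤ (Additive (𝓞 L)ˣ × ℤ) = Fintype.card (InfinitePlace L) := by
    have : Module.finrank ℤ (Additive (𝓞 L)ˣ × ℤ) = Units.rank L + 1 := by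
      have h := Submodule.finrank_quotient_add_finrank
        (LinearMap.ker (LinearMap.snd ℤ (Additive (𝓞 L)ˣ) ℤ))
      rw [(LinearMap.quotKerEquivOfSurjective _ (LinearMap.snd_surjective)).finrank_eq,
        LinearMap.ker_snd, LinearMap.finrank_range_of_inj LinearMap.inl_injective,
        Module.finrank_self, Units.finrank_eq] at h
      omega
    rw [this, Units.rank]
    have := Fintype.card_pos (α := InfinitePlace L)
    omega
  have h3 : Module.finrank ℤ ((Additive (𝓞 L)ˣ × ℤ) ⧸ f.range) = 0 := by
    have := Submodule.finrank_quotient_add_finrank f.range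
    omega
  have h4 : Finite ((Additive (𝓞 L)ˣ × ℤ) ⧸ f.range) :=
    Module.finite_of_fg_torsion _ (Module.finrank_eq_zero_iff_isTorsion.mp h3)
  exact (AddSubgroup.index_ne_zero_iff_finite (H := (basisHom y).range)).mpr h4

end UnitAction

section Herbrand

variable (K L : Type*) [Field K] [NumberField K] [Field L] [NumberField L] [Algebra K L]
  [IsGalois K L]

/-- The orbits of the Galois group on the infinite places of `L` are the infinite places of `K`, and
the order of a stabilizer is the ramification index. -/
theorem prod_card_stabilizer [Fintype (MulAction.orbitRel.Quotient Gal(L/K) (InfinitePlace L))] :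
    ∏ ω : MulAction.orbitRel.Quotient Gal(L/K) (InfinitePlace L),
      Nat.card (MulAction.stabilizer Gal(L/K) ω.out) =
    ∏ v : InfinitePlace K, infiniteRamificationIdx K L v := by
  refine Fintype.prod_equiv InfinitePlace.orbitRelEquiv _ _ fun ω => ?_
  classical
  rw [InfinitePlace.card_stabilizer, infiniteRamificationIdx]
  have : InfinitePlace.orbitRelEquiv ω = (ω.out).comap (algebraMap K L) := by
    conv_lhs => rw [← Quotient.out_eq ω]
    rfl
  rw [this]
  exact if_congr InfinitePlace.isUnramifiedIn_comap.symm rfl rfl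

/-- The Herbrand quotient of the unit group of a cyclic extension of number fields. -/
theorem herbrand_units {σ : Gal(L/K)} (hσ : ∀ τ, τ ∈ Subgroup.zpowers σ) :
    (normEnd Gal(L/K) (Additive (𝓞 L)ˣ)).range.relIndex (diffEnd (Additive (𝓞 L)ˣ) σ).ker *
        Module.finrank K L =
      (diffEnd (Additive (𝓞 L)ˣ) σ).range.relIndex (normEnd Gal(L/K) (Additive (𝓞 L)ˣ)).ker *
        ∏ v : InfinitePlace K, infiniteRamificationIdx K L v ∧
    (normEnd Gal(L/K) (Additive (𝓞 L)ˣ)).range.relIndex (diffEnd (Additive (𝓞 L)ˣ) σ).ker ≠ 0 ∧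
    (diffEnd (Additive (𝓞 L)ˣ) σ).range.relIndex
      (normEnd Gal(L/K) (Additive (𝓞 L)ˣ)).ker ≠ 0 := by
  classical
  obtain ⟨y, hy, hneg⟩ := exists_equivariant_units K L
  let n : ℤ := Fintype.card Gal(L/K)
  have hn : n ≠ 0 := Nat.cast_ne_zero.mpr Fintype.card_ne_zero
  -- on the trivial module `ℤ` the norm is multiplication by the group order, and `σ - 1` is zero
  have main := herbrand_of_finiteIndex (j := basisHom y) (basisHom_units_injective hneg)
    (index_range_basisHom_units_ne_zero hneg)
    (f := (normEnd Gal(L/K) (Additive (𝓞 L)ˣ)).prodMap (AddMonoidHom.mulLeft n))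
    (g := (diffEnd (Additive (𝓞 L)ˣ) σ).prodMap 0)
    (f' := permNorm Gal(L/K) (InfinitePlace L)) (g' := permDiff (InfinitePlace L) σ)
    (fun c => ?_) (fun c => ?_) (fun x => ?_) (fun x => ?_)
  · have hZ1 : (0 : ℤ →+ ℤ).range.relIndex (AddMonoidHom.mulLeft n).ker = 1 := by
      rw [AddSubgroup.relIndex_eq_one]
      intro x hx
      exact ⟨0, ((mul_eq_zero.mp (show n * x = 0 from hx)).resolve_left hn).symm⟩
    have hZ0 : (AddMonoidHom.mulLeft n).range.relIndex (0 : ℤ →+ ℤ).ker = Module.finrank K L := by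
      have h1 : (0 : ℤ →+ ℤ).ker = ⊤ := by ext; simp
      have h2 : (AddMonoidHom.mulLeft n).range = AddSubgroup.zmultiples n := by
        ext x
        rw [Int.mem_zmultiples_iff]
        exact ⟨fun ⟨c, hc⟩ => ⟨c, hc.symm⟩, fun ⟨c, hc⟩ => ⟨c, hc.symm⟩⟩
      rw [h1, h2, AddSubgroup.relIndex_top_right, Int.index_zmultiples, Int.natAbs_natCast,
        ← Nat.card_eq_fintype_card, IsGalois.card_aut_eq_finrank]
    have hfr : Module.finrank K L ≠ 0 := Module.finrank_pos.ne'
    rw [relIndex_range_prodMap, relIndex_range_prodMap, hZ1, hZ0, relIndex_range_permDiff hσ,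
      relIndex_range_permNorm hσ, prod_card_stabilizer, mul_one, mul_one] at main
    have hpos : ∏ v : InfinitePlace K, infiniteRamificationIdx K L v ≠ 0 :=
      Finset.prod_ne_zero_iff.mpr fun v _ => by
        unfold infiniteRamificationIdx
        split_ifs <;> norm_num
    exact ⟨main.1.symm, left_ne_zero_of_mul (main.2.2 hpos), main.2.1 one_ne_zero⟩
  · exact basisHom_permNorm hy c
  · exact basisHom_permDiff hy σ c
  · exact Prod.ext (normEnd_diffEnd σ x.1) (mul_zero n)
  · exact Prod.ext (diffEnd_normEnd σ x.1) rfl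

end Herbrand

/-! ### Unit cohomology in terms of `L` -/

section

variable {K L : Type*} [Field K] [Field L] [Algebra K L]

/-- The inclusion of the unit group of the ring of integers in the multiplicative group of the
field, written additively. -/
noncomputable def unitIncl (L : Type*) [Field L] : Additive (𝓞 L)ˣ →+ Additive Lˣ :=
  (Units.map (algebraMap (𝓞 L) L : 𝓞 L →* L)).toAdditive

theorem unitIncl_injective : Function.Injective (unitIncl L) := fun _ _ h =>
  Units.ext (RingOfIntegers.ext (congrArg (fun x : Additive Lˣ => (x.toMul : L)) h))

theorem unitIncl_smul (τ : Gal(L/K)) (u : Additive (𝓞 L)ˣ) :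
    unitIncl L (τ • u) = τ • unitIncl L u := rfl

/-- The inclusion of the multiplicative group of `K` in that of `L`, written additively. -/
def fieldIncl (K L : Type*) [Field K] [Field L] [Algebra K L] : Additive Kˣ →+ Additive Lˣ :=
  (Units.map (algebraMap K L : K →* L)).toAdditive

/-- The map of unit groups induced by the inclusion of the rings of integers, written additively. -/
noncomputable def unitExt (K L : Type*) [Field K] [Field L] [Algebra K L] :
    Additive (𝓞 K)ˣ →+ Additive (𝓞 L)ˣ :=
  (Units.map (algebraMap (𝓞 K) (𝓞 L) : 𝓞 K →* 𝓞 L)).toAdditive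

variable [NumberField K] [NumberField L] [IsGalois K L] {σ : Gal(L/K)}

theorem mem_range_algebraMap_of_generator (hσ : ∀ τ, τ ∈ Subgroup.zpowers σ) {x : L}
    (hx : σ x = x) : ∃ k : K, algebraMap K L k = x := by
  refine (IsGalois.mem_range_algebraMap_iff_fixed (F := K) x).mpr fun τ => ?_
  have hle : Subgroup.zpowers σ ≤ MulAction.stabilizer Gal(L/K) x := by
    rw [Subgroup.zpowers_le]
    exact hx
  exact hle (hσ τ)

/-- Hilbert's Theorem 90 for a cyclic extension, in arbitrary universes: an element of norm one is of
the form `y / σ y`. -/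
theorem exists_eq_mul_of_norm_eq_one (hσ : ∀ τ, τ ∈ Subgroup.zpowers σ) {x : L}
    (hx : Algebra.norm K x = 1) : ∃ y : L, y ≠ 0 ∧ x * σ y = y := by
  let P : ℕ → L := fun i => ∏ j ∈ Finset.range i, (σ ^ j) x
  have hP : ∀ i, x * σ (P i) = P (i + 1) := fun i => by
    simp only [P, map_prod]
    rw [Finset.prod_range_succ', mul_comm]
    simp [pow_succ']
  have hcard : orderOf σ = Fintype.card Gal(L/K) :=
    (orderOf_eq_card_of_forall_mem_zpowers hσ).trans Nat.card_eq_fintype_card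
  have hbij : Function.Bijective fun i : Fin (orderOf σ) => σ ^ (i : ℕ) :=
    (Fintype.bijective_iff_injective_and_card _).mpr
      ⟨fun i j h => Fin.ext (pow_injOn_Iio_orderOf i.2 j.2 h), by rw [Fintype.card_fin, hcard]⟩
  have hPn : P (orderOf σ) = 1 := by
    have h1 : algebraMap K L (Algebra.norm K x) = 1 := by rw [hx, map_one]
    rw [Algebra.norm_eq_prod_automorphisms] at h1
    rw [← h1, ← Function.Bijective.prod_comp hbij (fun τ : Gal(L/K) => τ x)]
    exact Finset.prod_range (fun j => (σ ^ j) x)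
  -- by independence of characters the Lagrange resolvent does not vanish identically
  obtain ⟨a, ha⟩ : ∃ a : L, ∑ i : Fin (orderOf σ), P i * (σ ^ (i : ℕ)) a ≠ 0 := by
    by_contra! h
    have hinj : Function.Injective
        fun i : Fin (orderOf σ) => ((σ ^ (i : ℕ) : Gal(L/K)) : L →* L) := fun i j hij =>
      hbij.1 (AlgEquiv.ext fun z => DFunLike.congr_fun hij z)
    have hli := (linearIndependent_monoidHom L L).comp _ hinj
    have h0 := Fintype.linearIndependent_iff.mp hli (fun i => P i)
      (by ext z; simpa [Finset.sum_apply] using h z) ⟨0, orderOf_pos σ⟩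
    exact one_ne_zero (h0 : P 0 = 0)
  refine ⟨_, ha, ?_⟩
  rw [Fin.sum_univ_eq_sum_range (fun i => P i * (σ ^ i) a), map_sum, Finset.mul_sum]
  have h1 : ∀ i, x * σ (P i * (σ ^ i) a) = P (i + 1) * (σ ^ (i + 1)) a := fun i => by
    rw [map_mul, ← mul_assoc, hP, pow_succ', AlgEquiv.mul_apply]
  simp_rw [h1]
  have h2 := Finset.sum_range_succ (fun i => P i * (σ ^ i) a) (orderOf σ)
  rw [Finset.sum_range_succ'] at h2
  have h3 : P 0 * (σ ^ 0) a = P (orderOf σ) * (σ ^ orderOf σ) a := by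
    rw [hPn, pow_orderOf_eq_one, pow_zero]
    simp [P]
  rw [h3] at h2
  exact add_right_cancel h2

theorem ker_diffEnd_field (hσ : ∀ τ, τ ∈ Subgroup.zpowers σ) :
    (diffEnd (Additive Lˣ) σ).ker = (fieldIncl K L).range := by
  ext x
  rw [AddMonoidHom.mem_ker, diffEnd_apply, sub_eq_zero]
  constructor
  · intro h
    have h' : σ (x.toMul : L) = x.toMul := congrArg (fun y : Additive Lˣ => (y.toMul : L)) h
    obtain ⟨k, hk⟩ := mem_range_algebraMap_of_generator hσ h'
    refine ⟨Additive.ofMul (Units.mk0 k ?_), Units.ext hk⟩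
    rintro rfl
    exact x.toMul.ne_zero (by rw [← hk, map_zero])
  · rintro ⟨k, rfl⟩
    exact Units.ext (σ.commutes _)

theorem ker_diffEnd_units (hσ : ∀ τ, τ ∈ Subgroup.zpowers σ) :
    (diffEnd (Additive (𝓞 L)ˣ) σ).ker = (unitExt K L).range := by
  ext x
  rw [AddMonoidHom.mem_ker, diffEnd_apply, sub_eq_zero]
  constructor
  · intro h
    have aux : ∀ y : 𝓞 L, σ (y : L) = y → ∃ k : 𝓞 K, algebraMap (𝓞 K) (𝓞 L) k = y := by
      intro y hy
      obtain ⟨k, hk⟩ := mem_range_algebraMap_of_generator hσ hy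
      have hint : IsIntegral ℤ k := by
        rw [← isIntegral_algebraMap_iff (algebraMap K L).injective, hk]
        exact y.isIntegral_coe
      exact ⟨⟨k, hint⟩, RingOfIntegers.ext hk⟩
    have h1 : σ ((x.toMul : 𝓞 L) : L) = (x.toMul : 𝓞 L) :=
      congrArg (fun y : Additive (𝓞 L)ˣ => ((y.toMul : 𝓞 L) : L)) h
    have h2 : σ (((x.toMul⁻¹ : (𝓞 L)ˣ) : 𝓞 L) : L) = ((x.toMul⁻¹ : (𝓞 L)ˣ) : 𝓞 L) :=
      congrArg (fun y : Additive (𝓞 L)ˣ => (((y.toMul⁻¹ : (𝓞 L)ˣ) : 𝓞 L) : L)) h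
    obtain ⟨a, ha⟩ := aux _ h1
    obtain ⟨b, hb⟩ := aux _ h2
    have hab : a * b = 1 := by
      apply FaithfulSMul.algebraMap_injective (𝓞 K) (𝓞 L)
      rw [map_mul, ha, hb, map_one, Units.mul_inv]
    exact ⟨Additive.ofMul ⟨a, b, hab, by rw [mul_comm, hab]⟩, Units.ext ha⟩
  · rintro ⟨k, rfl⟩
    exact Units.ext (RingOfIntegers.ext (σ.commutes _))

theorem coe_normEnd_units (u : Additive (𝓞 L)ˣ) :
    (((normEnd Gal(L/K) (Additive (𝓞 L)ˣ) u).toMul : 𝓞 L) : L) =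
      algebraMap K L (Algebra.norm K ((u.toMul : 𝓞 L) : L)) := by
  rw [Algebra.norm_eq_prod_automorphisms, normEnd_apply, toMul_sum, Units.coe_prod]
  exact map_prod (algebraMap (𝓞 L) L) _ _

theorem normEnd_units_eq (u : (𝓞 L)ˣ) :
    normEnd Gal(L/K) (Additive (𝓞 L)ˣ) (Additive.ofMul u) =
      unitExt K L (Additive.ofMul (Units.map (RingOfIntegers.norm K : 𝓞 L →* 𝓞 K) u)) :=
  Units.ext (RingOfIntegers.ext (coe_normEnd_units (Additive.ofMul u)))

/-- The zeroth Tate cohomology of the units is the group of units of `K` modulo norms. -/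
theorem relIndex_range_normEnd_units (hσ : ∀ τ, τ ∈ Subgroup.zpowers σ) :
    (normEnd Gal(L/K) (Additive (𝓞 L)ˣ)).range.relIndex (diffEnd (Additive (𝓞 L)ˣ) σ).ker =
      (unitNorms K L).index := by
  have hinj : Function.Injective (unitExt K L) :=
    Units.map_injective (FaithfulSMul.algebraMap_injective (𝓞 K) (𝓞 L))
  have h1 : (normEnd Gal(L/K) (Additive (𝓞 L)ˣ)).range =
      (Subgroup.toAddSubgroup (unitNorms K L)).map (unitExt K L) := by
    ext x
    constructor
    · rintro ⟨u, rfl⟩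
      exact ⟨_, ⟨u.toMul, rfl⟩, (normEnd_units_eq u.toMul).symm⟩
    · rintro ⟨_, ⟨u, rfl⟩, rfl⟩
      exact ⟨Additive.ofMul u, normEnd_units_eq u⟩
  rw [ker_diffEnd_units hσ, h1, AddMonoidHom.range_eq_map,
    AddSubgroup.relIndex_map_map_of_injective _ _ hinj, AddSubgroup.relIndex_top_right,
    Subgroup.index_toAddSubgroup]

/-- By Hilbert's Theorem 90, the first cohomology of the units is the group of elements `x` of `Lˣ`
such that `σ x / x` is a unit, modulo `Kˣ` and units. -/
theorem relIndex_range_diffEnd_units (hσ : ∀ τ, τ ∈ Subgroup.zpowers σ) :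
    (diffEnd (Additive (𝓞 L)ˣ) σ).range.relIndex (normEnd Gal(L/K) (Additive (𝓞 L)ˣ)).ker =
      ((unitIncl L).range ⊔ (fieldIncl K L).range).relIndex
        ((unitIncl L).range.comap (diffEnd (Additive Lˣ) σ)) := by
  have : IsCyclic Gal(L/K) := ⟨σ, hσ⟩
  have hcomm : ∀ u, unitIncl L (diffEnd _ σ u) = diffEnd _ σ (unitIncl L u) := fun u => by
    rw [diffEnd_apply, diffEnd_apply, map_sub, unitIncl_smul]
  have h1 : (diffEnd (Additive (𝓞 L)ˣ) σ).range.map (unitIncl L) =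
      (unitIncl L).range.map (diffEnd (Additive Lˣ) σ) := by
    ext x
    constructor
    · rintro ⟨_, ⟨u, rfl⟩, rfl⟩
      exact ⟨_, ⟨u, rfl⟩, (hcomm u).symm⟩
    · rintro ⟨_, ⟨u, rfl⟩, rfl⟩
      exact ⟨_, ⟨u, rfl⟩, hcomm u⟩
  have h2 : (normEnd Gal(L/K) (Additive (𝓞 L)ˣ)).ker.map (unitIncl L) =
      ((unitIncl L).range.comap (diffEnd (Additive Lˣ) σ)).map (diffEnd (Additive Lˣ) σ) := by
    ext x
    constructor
    · rintro ⟨u, hu, rfl⟩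
      have hnorm : Algebra.norm K ((u.toMul : 𝓞 L) : L) = 1 := by
        apply (algebraMap K L).injective
        rw [← coe_normEnd_units, show normEnd _ _ u = 0 from hu, map_one]
        rfl
      obtain ⟨y, hy0, hy⟩ := exists_eq_mul_of_norm_eq_one hσ hnorm
      have hy' : diffEnd (Additive Lˣ) σ (-Additive.ofMul (Units.mk0 y hy0)) = unitIncl L u := by
        rw [map_neg, diffEnd_apply, neg_sub, sub_eq_iff_eq_add]
        exact Units.ext hy.symm
      exact ⟨_, ⟨u, hy'.symm⟩, hy'⟩
    · rintro ⟨y, ⟨u, hu⟩, rfl⟩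
      refine ⟨u, ?_, hu⟩
      have hinj : Function.Injective (unitIncl L) := unitIncl_injective
      apply hinj
      rw [map_zero, normEnd_apply, map_sum]
      simp_rw [unitIncl_smul, hu]
      rw [← normEnd_apply, normEnd_diffEnd]
  rw [← AddSubgroup.relIndex_map_map_of_injective _ _ unitIncl_injective, h1, h2,
    ← AddSubgroup.relIndex_comap, AddSubgroup.comap_map_eq, ker_diffEnd_field hσ]

end

/-! ### Divisors of a Dedekind domain -/

section Divisors

open nonZeroDivisors

variable {R : Type*} (K : Type*) [CommRing R] [IsDedekindDomain R] [Field K] [Algebra R K]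
  [IsFractionRing R K]

/-- The divisor of an invertible fractional ideal: the family of its exponents at the maximal
ideals. -/
noncomputable def idealDiv : Additive (FractionalIdeal R⁰ K)ˣ →+ (HeightOneSpectrum R → ℤ) where
  toFun I P := FractionalIdeal.count K P (I.toMul : FractionalIdeal R⁰ K)
  map_zero' := by ext P; exact FractionalIdeal.count_one K P
  map_add' I J := by
    ext P
    exact FractionalIdeal.count_mul K P I.toMul.ne_zero J.toMul.ne_zero

theorem idealDiv_injective : Function.Injective (idealDiv (R := R) K) := by
  intro I J h
  have hI := FractionalIdeal.finprod_heightOneSpectrum_factorization' K I.toMul.ne_zero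
  have hJ := FractionalIdeal.finprod_heightOneSpectrum_factorization' K J.toMul.ne_zero
  exact Units.ext (hI.symm.trans ((finprod_congr fun P => congrArg _ (congrFun h P)).trans hJ))

theorem finite_support_idealDiv (I : Additive (FractionalIdeal R⁰ K)ˣ) :
    {P | idealDiv K I P ≠ 0}.Finite :=
  FractionalIdeal.finite_factors (I.toMul : FractionalIdeal R⁰ K)

variable (R) in
/-- The divisor of a nonzero element of the fraction field. -/
noncomputable def principalDiv : Additive Kˣ →+ (HeightOneSpectrum R → ℤ) :=
  (idealDiv K).comp (toPrincipalIdeal R K).toAdditive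

theorem finite_support_principalDiv (x : Additive Kˣ) : {P | principalDiv R K x P ≠ 0}.Finite :=
  finite_support_idealDiv K (Additive.ofMul (toPrincipalIdeal R K x.toMul))

theorem valuation_eq_exp_principalDiv (P : HeightOneSpectrum R) (x : Kˣ) :
    P.valuation K (x : K) = WithZero.exp (-principalDiv R K (Additive.ofMul x) P) := by
  have hint : ∀ (a : R) (ha : algebraMap R K a ≠ 0), P.valuation K (algebraMap R K a) =
      WithZero.exp (-principalDiv R K (Additive.ofMul (Units.mk0 _ ha)) P) := by
    intro a ha
    have ha0 : a ≠ 0 := fun h => ha (by rw [h, map_zero])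
    rw [HeightOneSpectrum.valuation_of_algebraMap, HeightOneSpectrum.intValuation_if_neg _ ha0]
    congr 2
    change _ = FractionalIdeal.count K P (toPrincipalIdeal R K (Units.mk0 _ ha) :
      FractionalIdeal R⁰ K)
    rw [coe_toPrincipalIdeal, Units.val_mk0, ← FractionalIdeal.coeIdeal_span_singleton,
      FractionalIdeal.count_coe]
    rwa [Ne, Ideal.zero_eq_bot, Ideal.span_singleton_eq_bot]
  obtain ⟨a, b, hb, hab⟩ := IsFractionRing.div_surjective (A := R) (x : K)
  have hb' : algebraMap R K b ≠ 0 :=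
    IsFractionRing.to_map_ne_zero_of_mem_nonZeroDivisors hb
  have ha' : algebraMap R K a ≠ 0 := fun h => x.ne_zero (by rw [← hab, h, zero_div])
  have hx : x = Units.mk0 _ ha' / Units.mk0 _ hb' := Units.ext (by
    rw [Units.val_div_eq_div_val]; exact hab.symm)
  rw [← hab, map_div₀, hint a ha', hint b hb', hx, ofMul_div, map_sub, ← WithZero.exp_sub]
  congr 1
  rw [Pi.sub_apply]
  ring

variable {K} in
theorem principalDiv_eq_iff {P : HeightOneSpectrum R} {x : Kˣ} {L S : Type*} [CommRing S]
    [IsDedekindDomain S] [Field L] [Algebra S L] [IsFractionRing S L] {Q : HeightOneSpectrum S}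
    {y : Lˣ} {e : ℕ} :
    principalDiv S L (Additive.ofMul y) Q = e * principalDiv R K (Additive.ofMul x) P ↔
      P.valuation K (x : K) ^ e = Q.valuation L (y : L) := by
  rw [valuation_eq_exp_principalDiv, valuation_eq_exp_principalDiv, ← WithZero.exp_nsmul,
    WithZero.exp_inj, nsmul_eq_mul, mul_neg, neg_inj, eq_comm]

/-- The homomorphism from the free abelian group on `ι` to the group of fractional ideals given by
a family of ideals. -/
noncomputable def familyIdeal {ι : Type*} (I : ι → (Ideal R)⁰) :
    (ι →₀ ℤ) →+ Additive (FractionalIdeal R⁰ K)ˣ :=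
  Finsupp.liftAddHom fun i => zmultiplesHom _ (Additive.ofMul (FractionalIdeal.mk0 K (I i)))

theorem idealDiv_familyIdeal {ι : Type*} (I : ι → (Ideal R)⁰) (d : ι →₀ ℤ)
    (P : HeightOneSpectrum R) :
    idealDiv K (familyIdeal K I d) P =
      d.sum fun i m => m * FractionalIdeal.count K P ((I i : Ideal R) : FractionalIdeal R⁰ K) := by
  rw [familyIdeal, Finsupp.liftAddHom_apply, map_finsuppSum, Finsupp.sum, Finset.sum_apply]
  refine Finset.sum_congr rfl fun i _ => ?_
  rw [zmultiplesHom_apply, map_zsmul, Pi.smul_apply, smul_eq_mul]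
  rfl

/-- The homomorphism from the free abelian group on `ι` to the class group given by a family of
ideals. -/
noncomputable def familyClass {ι : Type*} (I : ι → (Ideal R)⁰) :
    (ι →₀ ℤ) →+ Additive (ClassGroup R) :=
  Finsupp.liftAddHom fun i => zmultiplesHom _ (Additive.ofMul (ClassGroup.mk0 (I i)))

theorem familyClass_single {ι : Type*} (I : ι → (Ideal R)⁰) (i : ι) :
    familyClass I (Finsupp.single i 1) = Additive.ofMul (ClassGroup.mk0 (I i)) := by
  simp [familyClass]

theorem familyClass_eq {ι : Type*} (I : ι → (Ideal R)⁰) (d : ι →₀ ℤ) :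
    familyClass I d = Additive.ofMul (ClassGroup.mk K (familyIdeal K I d).toMul) := by
  have : familyClass I = (ClassGroup.mk K).toAdditive.comp (familyIdeal K I) := by
    ext i
    simp only [familyClass, familyIdeal, AddMonoidHom.comp_apply, Finsupp.singleAddHom_apply,
      Finsupp.liftAddHom_apply_single, zmultiplesHom_apply, one_zsmul]
    exact congrArg Additive.ofMul (ClassGroup.mk_mk0 K (I i)).symm
  rw [this]
  rfl

theorem mk_eq_one_iff_exists_toPrincipalIdeal (I : (FractionalIdeal R⁰ K)ˣ) :
    ClassGroup.mk K I = 1 ↔ ∃ x : Kˣ, toPrincipalIdeal R K x = I := by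
  rw [← (ClassGroup.equiv K).map_eq_one_iff, ClassGroup.equiv_mk, QuotientGroup.mk'_apply,
    QuotientGroup.eq_one_iff]
  have : (Units.mapEquiv
      ((FractionalIdeal.canonicalEquiv R⁰ K K : FractionalIdeal R⁰ K ≃+* FractionalIdeal R⁰ K) :
        FractionalIdeal R⁰ K ≃* FractionalIdeal R⁰ K)) I = I := Units.ext (by simp)
  rw [this]
  rfl

/-- The combination of ideals given by `d` is principal if and only if its divisor is the divisor of
an element. -/
theorem familyClass_eq_zero_iff {ι : Type*} (I : ι → (Ideal R)⁰) (d : ι →₀ ℤ) :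
    familyClass I d = 0 ↔
      ∃ x : Additive Kˣ, principalDiv R K x = idealDiv K (familyIdeal K I d) := by
  rw [familyClass_eq K, ofMul_eq_zero, mk_eq_one_iff_exists_toPrincipalIdeal]
  constructor
  · rintro ⟨x, hx⟩
    exact ⟨Additive.ofMul x, congrArg (fun J => idealDiv K (Additive.ofMul J)) hx⟩
  · rintro ⟨x, hx⟩
    exact ⟨x.toMul, idealDiv_injective K hx⟩

open Classical in
theorem count_asIdeal (P Q : HeightOneSpectrum R) :
    FractionalIdeal.count K P (Q.asIdeal : FractionalIdeal R⁰ K) = if Q = P then 1 else 0 :=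
  FractionalIdeal.count_maximal K P Q

variable (R) in
/-- The family of all maximal ideals. -/
def maximalIdeals (P : HeightOneSpectrum R) : (Ideal R)⁰ :=
  ⟨P.asIdeal, mem_nonZeroDivisors_iff_ne_zero.mpr P.ne_bot⟩

theorem idealDiv_familyIdeal_maximalIdeals (d : HeightOneSpectrum R →₀ ℤ) :
    idealDiv K (familyIdeal K (maximalIdeals R) d) = d := by
  classical
  ext P
  rw [idealDiv_familyIdeal, Finsupp.sum_eq_single P]
  · rw [maximalIdeals, count_asIdeal, if_pos rfl, mul_one]
  · intro Q _ hQ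
    rw [maximalIdeals, count_asIdeal, if_neg hQ, mul_zero]
  · intro _
    rw [zero_mul]

variable (R) in
/-- The class of a divisor. -/
noncomputable def divisorClass : (HeightOneSpectrum R →₀ ℤ) →+ Additive (ClassGroup R) :=
  familyClass (maximalIdeals R)

theorem mem_ker_divisorClass {d : HeightOneSpectrum R →₀ ℤ} :
    d ∈ (divisorClass R).ker ↔ ∃ x : Additive Kˣ, principalDiv R K x = d := by
  rw [AddMonoidHom.mem_ker, divisorClass, familyClass_eq_zero_iff K,
    idealDiv_familyIdeal_maximalIdeals]

theorem divisorClass_surjective : Function.Surjective (divisorClass R) := by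
  intro c
  obtain ⟨J, hJ⟩ := ClassGroup.mk0_surjective c.toMul
  let I : Additive (FractionalIdeal R⁰ (FractionRing R))ˣ :=
    Additive.ofMul (FractionalIdeal.mk0 _ J)
  let d : HeightOneSpectrum R →₀ ℤ :=
    Finsupp.ofSupportFinite _ (finite_support_idealDiv (FractionRing R) I)
  refine ⟨d, ?_⟩
  have h : familyIdeal (FractionRing R) (maximalIdeals R) d = I :=
    idealDiv_injective _ (idealDiv_familyIdeal_maximalIdeals _ d)
  rw [divisorClass, familyClass_eq (FractionRing R), h]
  exact congrArg Additive.ofMul ((ClassGroup.mk_mk0 _ J).trans hJ)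

/-- The group of principal divisors has index the class number. -/
theorem index_ker_divisorClass : (divisorClass R).ker.index = Nat.card (ClassGroup R) := by
  rw [AddSubgroup.index_ker, AddMonoidHom.range_eq_top.mpr divisorClass_surjective]
  exact Nat.card_congr (Equiv.Set.univ _)

/-- The kernel of the divisor map on a number field is the group of units. -/
theorem ker_principalDiv (L : Type*) [Field L] [NumberField L] :
    (principalDiv (𝓞 L) L).ker = (unitIncl L).range := by
  ext x
  constructor
  · intro hx
    have aux : ∀ y : Lˣ, principalDiv (𝓞 L) L (Additive.ofMul y) = 0 →
        ∃ a : 𝓞 L, (a : L) = y := fun y hy =>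
      HeightOneSpectrum.mem_integers_of_valuation_le_one L (y : L) fun P => by
        rw [valuation_eq_exp_principalDiv, hy]
        simp
    obtain ⟨a, ha⟩ := aux x.toMul hx
    obtain ⟨b, hb⟩ := aux (x.toMul)⁻¹ (by
      rw [ofMul_inv, map_neg, ofMul_toMul, show principalDiv (𝓞 L) L x = 0 from hx, neg_zero])
    have hab : a * b = 1 := RingOfIntegers.ext 
      ((map_mul (algebraMap (𝓞 L) L) a b).trans ((congrArg₂ (· * ·) ha hb).trans
        (x.toMul.mul_inv.trans (map_one (algebraMap (𝓞 L) L)).symm)))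
    exact ⟨Additive.ofMul ⟨a, b, hab, by rw [mul_comm, hab]⟩, Units.ext ha⟩
  · rintro ⟨u, rfl⟩
    have hnonneg : ∀ (u : Additive (𝓞 L)ˣ) P, 0 ≤ principalDiv (𝓞 L) L (unitIncl L u) P := by
      intro u P
      have h := P.valuation_le_one (K := L) (u.toMul : 𝓞 L)
      have h' := valuation_eq_exp_principalDiv L P (unitIncl L u).toMul
      rw [show ((unitIncl L u).toMul : L) = algebraMap (𝓞 L) L (u.toMul : 𝓞 L) from rfl] at h'
      rw [h', ← WithZero.exp_zero, WithZero.exp_le_exp] at h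
      rw [ofMul_toMul] at h
      omega
    rw [AddMonoidHom.mem_ker]
    ext P
    refine le_antisymm ?_ (hnonneg u P)
    have := hnonneg (-u) P
    rw [map_neg, map_neg, Pi.neg_apply] at this
    rw [Pi.zero_apply]
    omega

end Divisors

/-! ### Divisors in a Galois extension -/

section Scale

/-- The endomorphism of a free abelian group that multiplies the `i`-th coordinate by `e i`. -/
noncomputable def scale {ι : Type*} (e : ι → ℕ) : (ι →₀ ℤ) →+ (ι →₀ ℤ) where
  toFun d := Finsupp.onFinset d.support (fun i => e i * d i) fun i h =>
    Finsupp.mem_support_iff.mpr (right_ne_zero_of_mul h)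
  map_zero' := by ext; simp
  map_add' c d := by ext; simp [mul_add]

theorem scale_injective {ι : Type*} {e : ι → ℕ} (he : ∀ i, e i ≠ 0) :
    Function.Injective (scale e) := fun c d h => by
  ext i
  exact mul_left_cancel₀ (Nat.cast_ne_zero.mpr (he i)) (DFunLike.congr_fun h i)

theorem index_range_scale {ι : Type*} {e : ι → ℕ} (he : {i | e i ≠ 1}.Finite) :
    (scale e).range.index = ∏ᶠ i, e i := by
  classical
  let S := he.toFinset
  have hS : ∀ i, i ∉ S → e i = 1 := fun i hi => by simpa [S] using hi
  -- only the finitely many coordinates in `S` matter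
  let q : (ι →₀ ℤ) →+ (S → ℤ) :=
    { toFun := fun d i => d i
      map_zero' := rfl
      map_add' := fun _ _ => rfl }
  have hq : Function.Surjective q := fun c =>
    ⟨Finsupp.onFinset S (fun i => if h : i ∈ S then c ⟨i, h⟩ else 0) fun i h => by
      by_contra hi
      exact h (dif_neg hi), by ext i; exact dif_pos i.2⟩
  have hrange : (scale e).range =
      (AddSubgroup.pi Set.univ fun i : S => AddSubgroup.zmultiples (e i : ℤ)).comap q := by
    ext d
    constructor
    · rintro ⟨c, rfl⟩ i _
      exact Int.mem_zmultiples_iff.mpr (dvd_mul_right _ _)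
    · intro hd
      have hdvd : ∀ i, (e i : ℤ) ∣ d i := fun i => by
        by_cases hi : i ∈ S
        · exact Int.mem_zmultiples_iff.mp (hd ⟨i, hi⟩ trivial)
        · simp [hS i hi]
      refine ⟨Finsupp.onFinset d.support (fun i => d i / e i) fun i h => ?_, ?_⟩
      · rw [Finsupp.mem_support_iff]
        rintro h0
        exact h (by rw [h0, Int.zero_ediv])
      · ext i
        exact Int.mul_ediv_cancel' (hdvd i)
  rw [hrange, AddSubgroup.index_comap_of_surjective _ hq, AddSubgroup.index_pi,
    finprod_eq_prod_of_mulSupport_subset e (s := S) (by simp [S, Function.mulSupport])]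
  simp_rw [Int.index_zmultiples, Int.natAbs_natCast]
  exact Finset.prod_coe_sort S e

end Scale

section Galois

open scoped Pointwise

variable {K L : Type*} [Field K] [Field L] [Algebra K L]

theorem liesOver_under (P : HeightOneSpectrum (𝓞 L)) :
    P.asIdeal.LiesOver (P.under (𝓞 K)).asIdeal := ⟨rfl⟩

variable (K L) in
theorem under_surjective :
    Function.Surjective (HeightOneSpectrum.under (𝓞 K) (B := 𝓞 L)) := by
  rintro ⟨p, hp, hp0⟩
  obtain ⟨P, hP, rfl⟩ :=
    p.exists_ideal_over_prime_of_isIntegral_of_isDomain (S := 𝓞 L) (by simp)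
  refine ⟨⟨P, hP, ?_⟩, rfl⟩
  rintro rfl
  exact hp0 (Ideal.comap_bot_of_injective _ (FaithfulSMul.algebraMap_injective (𝓞 K) (𝓞 L)))

variable [NumberField L]

theorem principalDiv_smul (τ : Gal(L/K)) {P Q : HeightOneSpectrum (𝓞 L)}
    (h : τ • P.asIdeal = Q.asIdeal) (x : Additive Lˣ) :
    principalDiv (𝓞 L) L (τ • x) Q = principalDiv (𝓞 L) L x P := by
  have hint : ∀ a : 𝓞 L, P.intValuation a = Q.intValuation (τ • a) := by
    intro a
    by_cases ha : a = 0
    · simp [ha]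
    · have ha' : τ • a ≠ 0 := (smul_ne_zero_iff_ne τ).mpr ha
      rw [HeightOneSpectrum.intValuation_eq_exp_neg_multiplicity _ ha,
        HeightOneSpectrum.intValuation_eq_exp_neg_multiplicity _ ha', ← h]
      have h1 : Ideal.span {τ • a} = τ • Ideal.span {a} := by
        rw [Ideal.pointwise_smul_def, Ideal.map_span, Set.image_singleton]
        rfl
      rw [h1, ← multiplicity_map_eq (MulDistribMulAction.toMulEquiv (Ideal (𝓞 L)) τ)]
      rfl
  have key : P.valuation L (x.toMul : L) ^ 1 = Q.valuation L ((τ • x).toMul : L) := by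
    obtain ⟨a, b, hb, hab⟩ := IsFractionRing.div_surjective (A := 𝓞 L) (x.toMul : L)
    have h2 : ((τ • x).toMul : L) = algebraMap (𝓞 L) L (τ • a) / algebraMap (𝓞 L) L (τ • b) := by
      change τ (x.toMul : L) = _
      rw [← hab, map_div₀]
      rfl
    rw [h2, pow_one, ← hab, map_div₀, map_div₀]
    simp only [HeightOneSpectrum.valuation_of_algebraMap, hint]
  have := principalDiv_eq_iff.mpr key
  rwa [Nat.cast_one, one_mul] at this

variable [NumberField K]

/-- Only finitely many maximal ideals are ramified, as they divide the different. -/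
theorem finite_finiteRamificationIdx_ne_one [IsGalois K L] :
    {p : HeightOneSpectrum (𝓞 K) | finiteRamificationIdx K L p ≠ 1}.Finite := by
  have hfin : {P : HeightOneSpectrum (𝓞 L) | P.asIdeal ∣ differentIdeal (𝓞 K) (𝓞 L)}.Finite :=
    Ideal.finite_factors (differentIdeal_ne_bot)
  refine (hfin.image (HeightOneSpectrum.under (𝓞 K))).subset ?_
  intro p hp
  obtain ⟨P, rfl⟩ := under_surjective K L p
  refine ⟨P, ?_, rfl⟩
  by_contra h
  apply hp
  have := liesOver_under (K := K) P
  have hP := P.isPrime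
  have hunr := not_dvd_differentIdeal_iff.mp h
  rw [finiteRamificationIdx, Ideal.ramificationIdxIn_eq_ramificationIdx _ P.asIdeal Gal(L/K)]
  exact Ideal.ramificationIdx_eq_one_of_isUnramifiedAt

/-- The pullback of functions along the map from maximal ideals of `L` to those of `K`. -/
noncomputable def pullback (K L : Type*) [Field K] [NumberField K] [Field L] [NumberField L]
    [Algebra K L] : (HeightOneSpectrum (𝓞 K) →₀ ℤ) →+ (HeightOneSpectrum (𝓞 L) → ℤ) where
  toFun d P := d (P.under (𝓞 K))
  map_zero' := rfl
  map_add' _ _ := rfl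

theorem pullback_injective : Function.Injective (pullback K L) := fun c d h => by
  ext p
  obtain ⟨P, rfl⟩ := under_surjective K L p
  exact congrFun h P

variable [IsGalois K L]

theorem principalDiv_fieldIncl (x : Additive Kˣ) (P : HeightOneSpectrum (𝓞 L)) :
    principalDiv (𝓞 L) L (fieldIncl K L x) P =
      finiteRamificationIdx K L (P.under (𝓞 K)) * principalDiv (𝓞 K) K x (P.under (𝓞 K)) := by
  have := liesOver_under (K := K) P
  have hP := P.isPrime
  rw [finiteRamificationIdx, Ideal.ramificationIdxIn_eq_ramificationIdx _ P.asIdeal Gal(L/K),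
    ← Ideal.ramificationIdx'_eq_ramificationIdx (P.under (𝓞 K)).asIdeal P.asIdeal
      (P.under (𝓞 K)).ne_bot]
  exact principalDiv_eq_iff.mpr (HeightOneSpectrum.valuation_liesOver L (P.under (𝓞 K)) P _)

variable {σ : Gal(L/K)}

/-- The divisors of the elements `x` such that `σ x / x` is a unit are those among the divisors of
elements that are constant on the primes above each prime of `K`. -/
theorem map_principalDiv_comap_diffEnd (hσ : ∀ τ, τ ∈ Subgroup.zpowers σ) :
    ((unitIncl L).range.comap (diffEnd (Additive Lˣ) σ)).map (principalDiv (𝓞 L) L) =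
      (principalDiv (𝓞 L) L).range ⊓ (pullback K L).range := by
  ext f
  constructor
  · rintro ⟨x, hx, rfl⟩
    refine ⟨⟨x, rfl⟩, ?_⟩
    have hstab : ∀ (τ : Gal(L/K)) y, y ∈ (unitIncl L).range → τ • y ∈ (unitIncl L).range := by
      rintro τ _ ⟨u, rfl⟩
      exact ⟨τ • u, unitIncl_smul τ u⟩
    let H : Subgroup Gal(L/K) :=
      { carrier := {τ | τ • x - x ∈ (unitIncl L).range}
        one_mem' := by
          change (1 : Gal(L/K)) • x - x ∈ (unitIncl L).range
          rw [one_smul, sub_self]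
          exact zero_mem _
        mul_mem' := fun {a b} ha hb => by
          change (a * b) • x - x ∈ (unitIncl L).range
          rw [← sub_add_sub_cancel _ (a • x), mul_smul, ← smul_sub]
          exact add_mem (hstab a _ hb) ha
        inv_mem' := fun {a} ha => by
          change a⁻¹ • x - x ∈ (unitIncl L).range
          have := neg_mem (hstab a⁻¹ _ ha)
          rwa [smul_sub, inv_smul_smul, neg_sub] at this }
    have hle : Subgroup.zpowers σ ≤ H := by
      rw [Subgroup.zpowers_le]
      exact hx
    have hinv : ∀ τ : Gal(L/K), principalDiv (𝓞 L) L (τ • x) = principalDiv (𝓞 L) L x := by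
      intro τ
      have h1 : τ • x - x ∈ (principalDiv (𝓞 L) L).ker := by
        rw [ker_principalDiv]
        exact hle (hσ τ)
      rwa [AddMonoidHom.mem_ker, map_sub, sub_eq_zero] at h1
    have hfib : ∀ P Q : HeightOneSpectrum (𝓞 L), P.under (𝓞 K) = Q.under (𝓞 K) →
        principalDiv (𝓞 L) L x P = principalDiv (𝓞 L) L x Q := by
      intro P Q hPQ
      have h1 := liesOver_under (K := K) P
      have h2 := liesOver_under (K := K) Q
      rw [← hPQ] at h2
      have hP := P.isPrime
      have hQ := Q.isPrime
      obtain ⟨τ, hτ⟩ := Ideal.exists_smul_eq_of_isGaloisGroup (P.under (𝓞 K)).asIdeal P.asIdeal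
        Q.asIdeal Gal(L/K)
      rw [← principalDiv_smul τ hτ x, hinv]
    choose s hs using under_surjective K L
    have hfin : (Function.support fun p => principalDiv (𝓞 L) L x (s p)).Finite := by
      refine ((finite_support_principalDiv (R := 𝓞 L) L x).image
        (HeightOneSpectrum.under (𝓞 K))).subset ?_
      exact fun p hp => ⟨s p, hp, hs p⟩
    refine ⟨Finsupp.ofSupportFinite _ hfin, ?_⟩
    ext P
    exact hfib _ _ (hs _)
  · rintro ⟨⟨x, rfl⟩, ⟨d, hd⟩⟩
    refine ⟨x, ?_, rfl⟩
    rw [SetLike.mem_coe, AddSubgroup.mem_comap, ← ker_principalDiv, AddMonoidHom.mem_ker,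
      diffEnd_apply, map_sub, sub_eq_zero]
    ext Q
    have hQ := Q.isPrime
    let P : HeightOneSpectrum (𝓞 L) := HeightOneSpectrum.equivOfRingEquiv
      (MulSemiringAction.toRingEquiv Gal(L/K) (𝓞 L) σ⁻¹) Q
    have hP : P.asIdeal = σ⁻¹ • Q.asIdeal := Ideal.comap_symm _
    rw [principalDiv_smul σ (P := P) (by rw [hP, smul_inv_smul]), ← hd]
    refine congrArg d (HeightOneSpectrum.ext ?_)
    change P.asIdeal.under (𝓞 K) = Q.asIdeal.under (𝓞 K)
    rw [hP, Ideal.under_smul]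

end Galois

/-! ### The relative Pólya group -/

section Polya

open nonZeroDivisors

variable (K L : Type*) [Field K] [NumberField K] [Field L] [NumberField L] [Algebra K L]
  [IsGalois K L]

/-- All primes above `p` share one inertia degree, so `Π_{p^f}(L/K)` is the product of all of them
for that `f ≠ 0`, and the empty product for every other `f ≠ 0`. -/
theorem relNorm_eq_pow_inertiaDegIn_iff (p : HeightOneSpectrum (𝓞 K))
    (P : HeightOneSpectrum (𝓞 L)) (f : ℕ) :
    Ideal.relNorm (𝓞 K) P.asIdeal = p.asIdeal ^ f ∧ f ≠ 0 ↔
      P.under (𝓞 K) = p ∧ f = p.asIdeal.inertiaDegIn (𝓞 L) := by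
  have hover := liesOver_under (K := K) P
  have hP := P.isPrime
  have hPm := P.isMaximal
  have hpm := (P.under (𝓞 K)).isMaximal
  have hnorm : Ideal.relNorm (𝓞 K) P.asIdeal =
      (P.under (𝓞 K)).asIdeal ^ (P.under (𝓞 K)).asIdeal.inertiaDegIn (𝓞 L) := by
    rw [Ideal.inertiaDegIn_eq_inertiaDeg _ P.asIdeal Gal(L/K)]
    exact Ideal.relNorm_eq_pow_of_isMaximal _ _
  have hf0 : (P.under (𝓞 K)).asIdeal.inertiaDegIn (𝓞 L) ≠ 0 :=
    Ideal.inertiaDegIn_ne_zero Gal(L/K)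
  constructor
  · rintro ⟨h, hf⟩
    have hp : P.under (𝓞 K) = p := by
      rw [hnorm] at h
      refine HeightOneSpectrum.ext ((P.under (𝓞 K)).isMaximal.eq_of_le p.isPrime.ne_top ?_)
      exact p.isPrime.le_of_pow_le (h.le.trans (Ideal.pow_le_self hf))
    subst hp
    rw [hnorm] at h
    exact ⟨rfl, ((Ideal.pow_right_strictAnti _ (P.under (𝓞 K)).ne_bot
      (P.under (𝓞 K)).isPrime.ne_top).injective h).symm⟩
  · rintro ⟨rfl, rfl⟩
    exact ⟨hnorm, hf0⟩

/-- The product of the primes above `p`, as the ideal `Π_{p^f}(L/K)` for `f` the inertia degree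
of `p`. -/
noncomputable def primesProd (p : HeightOneSpectrum (𝓞 K)) : (Ideal (𝓞 L))⁰ :=
  ⟨prodIdeal K L p (p.asIdeal.inertiaDegIn (𝓞 L)), prodIdeal_mem_nonZeroDivisors K L p _⟩

theorem inertiaDegIn_ne_zero (p : HeightOneSpectrum (𝓞 K)) :
    p.asIdeal.inertiaDegIn (𝓞 L) ≠ 0 := by
  have := p.isPrime
  exact Ideal.inertiaDegIn_ne_zero Gal(L/K)

open Classical in
theorem count_primesProd (p : HeightOneSpectrum (𝓞 K)) (P : HeightOneSpectrum (𝓞 L)) :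
    FractionalIdeal.count L P ((primesProd K L p : Ideal (𝓞 L)) : FractionalIdeal (𝓞 L)⁰ L) =
      if p = P.under (𝓞 K) then 1 else 0 := by
  simp only [primesProd, prodIdeal]
  rw [← FractionalIdeal.coeIdealHom_apply, map_prod]
  simp only [FractionalIdeal.coeIdealHom_apply]
  rw [FractionalIdeal.count_prod]
  · simp_rw [count_asIdeal]
    rw [Finset.sum_ite_eq']
    refine if_congr ?_ rfl rfl
    rw [Set.Finite.mem_toFinset, Set.mem_ofPred_eq]
    have h := relNorm_eq_pow_inertiaDegIn_iff K L p P (p.asIdeal.inertiaDegIn (𝓞 L))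
    rw [and_iff_left (inertiaDegIn_ne_zero K L p), and_iff_left rfl] at h
    rw [h, eq_comm]
  · exact fun Q _ => FractionalIdeal.coeIdeal_ne_zero.mpr Q.ne_bot

theorem idealDiv_familyIdeal_primesProd (d : HeightOneSpectrum (𝓞 K) →₀ ℤ) :
    idealDiv L (familyIdeal L (primesProd K L) d) = pullback K L d := by
  classical
  ext P
  rw [idealDiv_familyIdeal, Finsupp.sum_eq_single (P.under (𝓞 K))]
  · rw [count_primesProd, if_pos rfl, mul_one]
    rfl
  · intro Q _ hQ
    rw [count_primesProd, if_neg hQ, mul_zero]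
  · intro _
    rw [zero_mul]

theorem toAddSubgroup_polyaGroup :
    Subgroup.toAddSubgroup (polyaGroup K L) = (familyClass (primesProd K L)).range := by
  apply le_antisymm
  · change polyaGroup K L ≤ AddSubgroup.toSubgroup' (familyClass (primesProd K L)).range
    rw [polyaGroup, Subgroup.closure_le]
    rintro _ ⟨p, f, hf, rfl⟩
    by_cases h : f = p.asIdeal.inertiaDegIn (𝓞 L)
    · subst h
      exact ⟨Finsupp.single p 1, familyClass_single _ p⟩
    · -- for any other exponent the product is empty
      have h1 : prodIdeal K L p f = 1 := by
        refine Finset.prod_eq_one fun P hP => (h ?_).elim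
        rw [Set.Finite.mem_toFinset, Set.mem_ofPred_eq] at hP
        exact ((relNorm_eq_pow_inertiaDegIn_iff K L p P f).mp ⟨hP, by omega⟩).2
      have h2 : (⟨prodIdeal K L p f, prodIdeal_mem_nonZeroDivisors K L p f⟩ : (Ideal (𝓞 L))⁰) = 1 :=
        Subtype.ext h1
      rw [h2, map_one]
      exact one_mem _
  · rintro _ ⟨d, rfl⟩
    rw [familyClass, Finsupp.liftAddHom_apply, Finsupp.sum]
    refine sum_mem fun p _ => AddSubgroup.zsmul_mem _ ?_ _
    exact (Subgroup.subset_closure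
      ⟨p, _, Nat.one_le_iff_ne_zero.mpr (inertiaDegIn_ne_zero K L p), rfl⟩ :
      ClassGroup.mk0 (primesProd K L p) ∈ polyaGroup K L)

theorem card_polyaGroup :
    Nat.card (polyaGroup K L) = (familyClass (primesProd K L)).ker.index := by
  rw [AddSubgroup.index_ker, ← toAddSubgroup_polyaGroup]
  rfl

variable {K L} in
/-- The ambiguous class number formula in cohomological form. -/
theorem relIndex_mul_card_polyaGroup {σ : Gal(L/K)} (hσ : ∀ τ, τ ∈ Subgroup.zpowers σ) :
    (diffEnd (Additive (𝓞 L)ˣ) σ).range.relIndex (normEnd Gal(L/K) (Additive (𝓞 L)ˣ)).ker *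
        Nat.card (polyaGroup K L) =
      classNumber K * ∏ᶠ p : HeightOneSpectrum (𝓞 K), finiteRamificationIdx K L p := by
  let e := finiteRamificationIdx K L
  have he : ∀ p, e p ≠ 0 := fun p => by
    have := p.isPrime
    exact Ideal.ramificationIdxIn_ne_zero Gal(L/K)
  -- `B` is the group of divisors of elements of `K`, extended to `L`
  let B := (divisorClass (𝓞 K)).ker.map (scale e)
  let T := (unitIncl L).range.comap (diffEnd (Additive Lˣ) σ)
  have hB : B.map (pullback K L) = (fieldIncl K L).range.map (principalDiv (𝓞 L) L) := by
    have hpull : ∀ (x : Additive Kˣ) (d : HeightOneSpectrum (𝓞 K) →₀ ℤ),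
        principalDiv (𝓞 K) K x = d →
        pullback K L (scale e d) = principalDiv (𝓞 L) L (fieldIncl K L x) := by
      intro x d hd
      ext P
      rw [principalDiv_fieldIncl, hd]
      rfl
    ext f
    constructor
    · rintro ⟨_, ⟨d, hd, rfl⟩, rfl⟩
      obtain ⟨x, hx⟩ := (mem_ker_divisorClass K).mp hd
      exact ⟨fieldIncl K L x, ⟨x, rfl⟩, (hpull x d hx).symm⟩
    · rintro ⟨_, ⟨x, rfl⟩, rfl⟩
      let d : HeightOneSpectrum (𝓞 K) →₀ ℤ :=
        Finsupp.ofSupportFinite (principalDiv (𝓞 K) K x) (finite_support_principalDiv K x)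
      exact ⟨scale e d, ⟨d, (mem_ker_divisorClass K).mpr ⟨x, rfl⟩, rfl⟩, hpull x d rfl⟩
  have hR : (familyClass (primesProd K L)).ker.map (pullback K L) =
      T.map (principalDiv (𝓞 L) L) := by
    rw [map_principalDiv_comap_diffEnd hσ]
    ext f
    constructor
    · rintro ⟨d, hd, rfl⟩
      obtain ⟨x, hx⟩ := (familyClass_eq_zero_iff L _ _).mp hd
      rw [idealDiv_familyIdeal_primesProd] at hx
      exact ⟨⟨x, hx⟩, ⟨d, rfl⟩⟩
    · rintro ⟨⟨x, hx⟩, ⟨d, rfl⟩⟩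
      refine ⟨d, (familyClass_eq_zero_iff L _ _).mpr ⟨x, ?_⟩, rfl⟩
      rw [idealDiv_familyIdeal_primesProd, hx]
  have hle : B ≤ (familyClass (primesProd K L)).ker := by
    rw [← AddSubgroup.map_le_map_iff_of_injective (pullback_injective (K := K) (L := L)), hB, hR]
    refine AddSubgroup.map_mono ?_
    rw [← ker_diffEnd_field hσ]
    intro x hx
    rw [AddSubgroup.mem_comap, show diffEnd _ σ x = 0 from hx]
    exact zero_mem _
  rw [relIndex_range_diffEnd_units hσ, sup_comm, ← ker_principalDiv, ← AddSubgroup.comap_map_eq,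
    AddSubgroup.relIndex_comap, ker_principalDiv, ← hB, ← hR,
    AddSubgroup.relIndex_map_map_of_injective _ _ pullback_injective, card_polyaGroup,
    AddSubgroup.relIndex_mul_index hle, AddSubgroup.index_map_of_injective _ (scale_injective he),
    index_ker_divisorClass, index_range_scale finite_finiteRamificationIdx_ne_one,
    Nat.card_eq_fintype_card]
  rfl

end Polya

end RelativePolya

theorem mainTheorem9 (K L : Type*) [Field K] [NumberField K] [Field L] [NumberField L]
    [Algebra K L] [IsGalois K L] [IsCyclic (L ≃ₐ[K] L)] :
    {p : HeightOneSpectrum (𝓞 K) | RelativePolya.finiteRamificationIdx K L p ≠ 1}.Finite ∧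
    (RelativePolya.unitNorms K L).index ≠ 0 ∧
    (Nat.card (RelativePolya.polyaGroup K L) : ℚ) =
      (classNumber K : ℚ) / (Module.finrank K L : ℚ) *
        ((((∏ᶠ p : HeightOneSpectrum (𝓞 K), RelativePolya.finiteRamificationIdx K L p : ℕ) : ℚ) *
            ((∏ v : InfinitePlace K, RelativePolya.infiniteRamificationIdx K L v : ℕ) : ℚ)) /
          ((RelativePolya.unitNorms K L).index : ℚ)) := by
  obtain ⟨σ, hσ⟩ := IsCyclic.exists_generator (α := L ≃ₐ[K] L)
  obtain ⟨hq, h0, h1⟩ := RelativePolya.herbrand_units K L hσ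
  have hcard := RelativePolya.relIndex_mul_card_polyaGroup hσ
  rw [RelativePolya.relIndex_range_normEnd_units hσ] at hq h0
  refine ⟨RelativePolya.finite_finiteRamificationIdx_ne_one, h0, ?_⟩
  have hn : (Module.finrank K L : ℚ) ≠ 0 := Nat.cast_ne_zero.mpr Module.finrank_pos.ne'
  have hq' := congrArg (Nat.cast : ℕ → ℚ) hq
  have hcard' := congrArg (Nat.cast : ℕ → ℚ) hcard
  rw [Nat.cast_mul, Nat.cast_mul] at hq' hcard'
  have h0' : ((RelativePolya.unitNorms K L).index : ℚ) ≠ 0 := Nat.cast_ne_zero.mpr h0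
  rw [div_mul_div_comm, eq_div_iff (mul_ne_zero hn h0')]
  apply mul_left_cancel₀ (Nat.cast_ne_zero.mpr h1 : (_ : ℚ) ≠ 0)
  linear_combination (Module.finrank K L : ℚ) * ((RelativePolya.unitNorms K L).index : ℚ) * hcard' +
    (classNumber K : ℚ) *
      ((∏ᶠ p : HeightOneSpectrum (𝓞 K), RelativePolya.finiteRamificationIdx K L p : ℕ) : ℚ) * hq'
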